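/- Let ${\mathcal A}$ be a finite nonempty collection of hyperplanes (codimension-one linear subspaces) in $\mathbb R^n$. Its regions are the closures of the connected components of the complement of the union of the hyperplanes. Fix a base region $B$. For a region $R$ let $S(R)\subseteq{\mathcal A}$ be the set of hyperplanes separating $R$ from $B$, and let ${\mathcal P}({\mathcal A},B)$ be the set of regions ordered by $R_1\le R_2$ if and only if $S(R_1)\subseteq S(R_2)$. For a codimension-two subspace $L$ contained in at least two hyperplanes of ${\mathcal A}$, the set ${\mathcal A}'$ of all hyperplanes of ${\mathcal A}$ containing $L$ is called a rank-two subarrangement; the hyperplanes of ${\mathcal A}'$ that bound (i.e. meet in dimension $n-1$) the region of ${\mathcal A}'$ containing $B$ are called basic in ${\mathcal A}'$. The basic digraph ${\mathcal D}({\mathcal A},B)$ has vertex set ${\mathcal A}$ and an edge $H_1\to H_2$, for $H_1\ne H_2$, whenever $H_1$ is basic in the rank-two subarrangement of hyperplanes containing $H_1\cap H_2$. Put $\nu(H)=\{H'\in{\mathcal A}: H\to H'\}$. The shards in $H\in{\mathcal A}$ are the connected components of the set obtained from $H$ by removing, for every rank-two subarrangement that contains $H$ and in which $H$ is not basic, the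 codimension-two subspace $L$ that defines it. The upper regions of a shard $\Sigma$ in $H$ are the regions $R$ with $H\in S(R)$ for which $R\cap\Sigma$ has dimension $n-1$. A pair $(J,M)$ of regions is subcritical if $J\not\le M$, every $X<J$ satisfies $X\le M$, and every $X>M$ satisfies $X\ge J$. The hyperplane associated to a subcritical pair $(J,M)$ is the $H\in{\mathcal A}$ for which $J$ is minimal in ${\mathcal P}({\mathcal A},B)$ among the upper regions of some shard contained in $H$. For each $H\in{\mathcal A}$ let $n_H$ be a normal vector of $H$, with the directions chosen so that, for each region $R$, the set $S(R)$ consists exactly of those $H$ with $\langle x,n_H\rangle>0$ for every $x$ in the interior of $R$. Let $b_1,\dots,b_n$ be a basis of $\mathbb R^n$, write $v_i$ for the coefficient of $b_i$ in the expansion of a vector $v$, and let $Z_i(R)=\bigl(\sum_{H\in S(R)}n_H\bigr)_i$. Proposition. Let $H\in{\mathcal A}$ and $i\in\{1,\dots,n\}$. Suppose that $(n_{H'})_i\ge 0$ for every $H'\in\nu(H)$ (which holds in particular whenever $Z_i$ is order-preserving) and that $$(n_H)_i>\sum_{H'\in\nu(H)}(n_{H'})_i .$$ Then $Z_i$ reverses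 every subcritical pair $(J,M)$ whose associated hyperplane is $H$, that is, $Z_i(M)<Z_i(J)$ for every such pair. -/

import Mathlib

noncomputable section

open scoped InnerProductSpace

/-- A subcritical pair of a poset. -/
def Subcritical {P : Type*} [PartialOrder P] (j m : P) : Prop :=
  ¬ j ≤ m ∧ (∀ x, x < j → x ≤ m) ∧ (∀ x, m < x → j ≤ x)

/-- A map `η` from a poset to the reals reverses the pair `(j, m)` if `η m < η j`. -/
def Reverses {P : Type*} [PartialOrder P] (η : P → ℝ) (j m : P) : Prop :=
  η m < η j

/-- The complement of the union of a finite collection of subspaces of `ℝⁿ`. -/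
def arrComplement {n : ℕ} (A : Finset (Submodule ℝ (EuclideanSpace ℝ (Fin n)))) :
    Set (EuclideanSpace ℝ (Fin n)) :=
  {x | ∀ H ∈ A, x ∉ H}

/-- Regions: the closures of the connected components of the complement. -/
def IsRegion {n : ℕ} (A : Finset (Submodule ℝ (EuclideanSpace ℝ (Fin n))))
    (R : Set (EuclideanSpace ℝ (Fin n))) : Prop :=
  ∃ x ∈ arrComplement A, R = closure (connectedComponentIn (arrComplement A) x)

/-- The hyperplane `H` separates the sets `R₁` and `R₂`: they lie in opposite closed half-spaces
bounded by `H`. -/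
def Separates {n : ℕ} (H : Submodule ℝ (EuclideanSpace ℝ (Fin n)))
    (R₁ R₂ : Set (EuclideanSpace ℝ (Fin n))) : Prop :=
  ∃ f : EuclideanSpace ℝ (Fin n) →ₗ[ℝ] ℝ, LinearMap.ker f = H ∧
    (∀ x ∈ R₁, f x ≤ 0) ∧ (∀ x ∈ R₂, 0 ≤ f x)

/-- The set `T` meets the hyperplane `H` in codimension one (in dimension `n - 1`). -/
def MeetsInCodimOne {n : ℕ} (T : Set (EuclideanSpace ℝ (Fin n)))
    (H : Submodule ℝ (EuclideanSpace ℝ (Fin n))) : Prop :=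
  Submodule.span ℝ (T ∩ (H : Set (EuclideanSpace ℝ (Fin n)))) = H

/-- A (central) arrangement: a finite nonempty collection of codimension one linear subspaces
of `ℝⁿ`. -/
structure Arrangement (n : ℕ) where
  hyperplanes : Finset (Submodule ℝ (EuclideanSpace ℝ (Fin n)))
  nonempty : hyperplanes.Nonempty
  codim_one : ∀ H ∈ hyperplanes, Module.finrank ℝ (EuclideanSpace ℝ (Fin n) ⧸ H) = 1

namespace Arrangement

variable {n : ℕ} (A : Arrangement n)

/-- The regions of the arrangement. -/
def Region : Type := {R : Set (EuclideanSpace ℝ (Fin n)) // IsRegion A.hyperplanes R}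

open Classical in
/-- `S(R₁, R₂)`, the set of hyperplanes of the arrangement separating `R₁` from `R₂`. -/
def sep (R₁ R₂ : A.Region) : Finset A.hyperplanes :=
  Finset.univ.filter fun H => Separates H.1 R₁.1 R₂.1

/-- The underlying set of the poset of regions with base region `B`. -/
def PosetOfRegions (_B : A.Region) : Type := A.Region

/-- The separating set `S(R) = S(R, B)`. -/
def sepSet (B : A.Region) (R : A.PosetOfRegions B) : Finset A.hyperplanes := A.sep R B

variable {A}

theorem exists_ker_eq {H : Submodule ℝ (EuclideanSpace ℝ (Fin n))} (hH : H ∈ A.hyperplanes) :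
    ∃ f : EuclideanSpace ℝ (Fin n) →ₗ[ℝ] ℝ, LinearMap.ker f = H := by
  have e : (EuclideanSpace ℝ (Fin n) ⧸ H) ≃ₗ[ℝ] ℝ :=
    LinearEquiv.ofFinrankEq _ _ (by rw [A.codim_one H hH, Module.finrank_self])
  refine ⟨e.toLinearMap ∘ₗ H.mkQ, ?_⟩
  rw [LinearEquiv.ker_comp, Submodule.ker_mkQ]

theorem pos_of_mem {f : EuclideanSpace ℝ (Fin n) →ₗ[ℝ] ℝ}
    (hf : LinearMap.ker f ∈ A.hyperplanes) {x : EuclideanSpace ℝ (Fin n)}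
    (hx : x ∈ arrComplement A.hyperplanes) (h0 : 0 < f x) {y : EuclideanSpace ℝ (Fin n)}
    (hy : y ∈ closure (connectedComponentIn (arrComplement A.hyperplanes) x)) : 0 ≤ f y := by
  have hc : Continuous f := f.continuous_of_finiteDimensional
  have key : connectedComponentIn (arrComplement A.hyperplanes) x ⊆ {z | 0 ≤ f z} := by
    intro z hz
    by_contra hneg
    simp only [Set.mem_ofPred_eq, not_le] at hneg
    obtain ⟨w, hw, hw0⟩ := isPreconnected_connectedComponentIn.intermediate_value hz
      (mem_connectedComponentIn hx) hc.continuousOn ⟨hneg.le, h0.le⟩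
    exact connectedComponentIn_subset _ _ hw _ hf hw0
  exact closure_minimal key (isClosed_le continuous_const hc) hy

theorem separates_iff {f : EuclideanSpace ℝ (Fin n) →ₗ[ℝ] ℝ}
    (hf : LinearMap.ker f ∈ A.hyperplanes) {x y : EuclideanSpace ℝ (Fin n)}
    (hx : x ∈ arrComplement A.hyperplanes) (hy : y ∈ arrComplement A.hyperplanes) :
    Separates (LinearMap.ker f)
      (closure (connectedComponentIn (arrComplement A.hyperplanes) x))
      (closure (connectedComponentIn (arrComplement A.hyperplanes) y)) ↔ f x * f y < 0 := by
  have hfx : f x ≠ 0 := fun h => hx _ hf h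
  have hfy : f y ≠ 0 := fun h => hy _ hf h
  have aux : ∀ g : EuclideanSpace ℝ (Fin n) →ₗ[ℝ] ℝ, LinearMap.ker g = LinearMap.ker f →
      g x < 0 → 0 < g y → Separates (LinearMap.ker f)
      (closure (connectedComponentIn (arrComplement A.hyperplanes) x))
      (closure (connectedComponentIn (arrComplement A.hyperplanes) y)) := by
    intro g hg h1 h2
    refine ⟨g, hg, fun z hz => ?_, fun z hz => pos_of_mem (hg ▸ hf) hy h2 hz⟩
    have hn : LinearMap.ker (-g) ∈ A.hyperplanes := by
      have : LinearMap.ker (-g) = LinearMap.ker g := by ext; simp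
      rw [this, hg]; exact hf
    have := pos_of_mem hn hx (by simpa using h1) hz
    simpa using this
  constructor
  · rintro ⟨g, hg, h1, h2⟩
    have hgx : g x ≤ 0 := h1 x (subset_closure (mem_connectedComponentIn hx))
    have hgy : 0 ≤ g y := h2 y (subset_closure (mem_connectedComponentIn hy))
    have hgx0 : g x ≠ 0 := fun h => hfx (by
      have : x ∈ LinearMap.ker f := hg ▸ h
      exact this)
    have hgy0 : g y ≠ 0 := fun h => hfy (by
      have : y ∈ LinearMap.ker f := hg ▸ h
      exact this)
    have hz : f x • y - f y • x ∈ LinearMap.ker g := by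
      rw [hg, LinearMap.mem_ker]; simp [mul_comm]
    have hrel : f x * g y = f y * g x := by
      have := LinearMap.mem_ker.1 hz
      simp at this; linarith
    have hneg : g x * g y < 0 := mul_neg_of_neg_of_pos (lt_of_le_of_ne hgx hgx0)
      (lt_of_le_of_ne hgy (Ne.symm hgy0))
    have h3 : (f x * f y) * (g y) ^ 2 = (f y) ^ 2 * (g x * g y) := by
      linear_combination (f y * g y) * hrel
    have h4 : (f y) ^ 2 * (g x * g y) < 0 := mul_neg_of_pos_of_neg (by positivity) hneg
    by_contra hcon
    have : 0 ≤ (f x * f y) * (g y) ^ 2 := mul_nonneg (not_lt.1 hcon) (sq_nonneg _)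
    linarith
  · intro h
    rcases lt_or_gt_of_ne hfx with h1 | h1
    · exact aux f rfl h1 (by nlinarith [pos_of_mul_neg_right h h1.le])
    · refine aux (-f) (by ext; simp) (by simpa using h1) ?_
      have := neg_of_mul_neg_right h h1.le
      simpa using this

theorem sepSet_injective (B : A.Region) : Function.Injective (A.sepSet B) := by
  rintro ⟨R₁, x₁, hx₁, rfl⟩ ⟨R₂, x₂, hx₂, rfl⟩ h
  obtain ⟨R, b, hb, rfl⟩ := B
  have hsign : ∀ H ∈ A.hyperplanes, ∀ f : EuclideanSpace ℝ (Fin n) →ₗ[ℝ] ℝ,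
      LinearMap.ker f = H → 0 < f x₁ * f x₂ := by
    rintro H hH f rfl
    have h1 : f x₁ ≠ 0 := fun h => hx₁ _ hH h
    have h2 : f x₂ ≠ 0 := fun h => hx₂ _ hH h
    have h3 : f b ≠ 0 := fun h => hb _ hH h
    have hiff : f x₁ * f b < 0 ↔ f x₂ * f b < 0 := by
      rw [← separates_iff hH hx₁ hb, ← separates_iff hH hx₂ hb]
      have := Finset.ext_iff.1 h ⟨_, hH⟩
      simpa [sepSet, sep] using this
    by_contra hcon
    have h12 : f x₁ * f x₂ < 0 := lt_of_le_of_ne (not_lt.1 hcon) (mul_ne_zero h1 h2)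
    have hprod : (f x₁ * f b) * (f x₂ * f b) < 0 := by
      have : (f x₁ * f b) * (f x₂ * f b) = (f x₁ * f x₂) * (f b) ^ 2 := by ring
      rw [this]
      exact mul_neg_of_neg_of_pos h12 (by positivity)
    by_cases hc : f x₁ * f b < 0
    · exact absurd (mul_pos_of_neg_of_neg hc (hiff.1 hc)) (not_lt.2 hprod.le)
    · have hc' : ¬ f x₂ * f b < 0 := fun h' => hc (hiff.2 h')
      exact absurd (mul_nonneg (not_lt.1 hc) (not_lt.1 hc')) (not_le.2 hprod)
  have hseg : segment ℝ x₁ x₂ ⊆ arrComplement A.hyperplanes := by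
    rintro z ⟨s, t, hs, ht, hst, rfl⟩ H hH hz
    obtain ⟨f, hf⟩ := exists_ker_eq hH
    have hp := hsign H hH f hf
    rw [← hf, LinearMap.mem_ker] at hz
    simp only [map_add, map_smul, smul_eq_mul] at hz
    have h1 : f x₁ ≠ 0 := left_ne_zero_of_mul hp.ne'
    have e : s * (f x₁) ^ 2 + t * (f x₁ * f x₂) = 0 := by
      linear_combination (f x₁) * hz
    have hsq : 0 < (f x₁) ^ 2 := by positivity
    have hs0 : s = 0 := by
      by_contra hs0
      have : 0 < s := lt_of_le_of_ne hs (Ne.symm hs0)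
      have := mul_pos this hsq
      have := mul_nonneg ht hp.le
      linarith
    have ht1 : t = 1 := by linarith
    rw [hs0, ht1] at e
    linarith
  have hmem : x₂ ∈ connectedComponentIn (arrComplement A.hyperplanes) x₁ :=
    (convex_segment x₁ x₂).isPreconnected.subset_connectedComponentIn
      (left_mem_segment ℝ x₁ x₂) hseg (right_mem_segment ℝ x₁ x₂)
  apply Subtype.ext
  show closure _ = closure _
  rw [connectedComponentIn_eq hmem]

variable (A)

/-- The poset of regions: `R₁ ≤ R₂` if and only if `S(R₁) ⊆ S(R₂)`. -/
instance (B : A.Region) : PartialOrder (A.PosetOfRegions B) :=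
  PartialOrder.lift (A.sepSet B) (sepSet_injective B)

open Classical in
/-- The hyperplanes of the arrangement containing the subspace `L`. -/
def containing (L : Submodule ℝ (EuclideanSpace ℝ (Fin n))) :
    Finset (Submodule ℝ (EuclideanSpace ℝ (Fin n))) :=
  A.hyperplanes.filter fun H => L ≤ H

/-- `L` is a codimension two subspace defining a rank-two subarrangement, which then is
`A.containing L`. -/
def DefinesRankTwo (L : Submodule ℝ (EuclideanSpace ℝ (Fin n))) : Prop :=
  Module.finrank ℝ (EuclideanSpace ℝ (Fin n) ⧸ L) = 2 ∧ 1 < (A.containing L).card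

/-- `H` is basic in the rank-two subarrangement `A' = A.containing L`: it bounds the region `B'`
of `A'` containing the base region `B`. -/
def IsBasic (B : A.Region) (L H : Submodule ℝ (EuclideanSpace ℝ (Fin n))) : Prop :=
  H ∈ A.containing L ∧
    ∃ B', IsRegion (A.containing L) B' ∧ B.1 ⊆ B' ∧ MeetsInCodimOne B' H

/-- The basic digraph: `H₁ → H₂` whenever `H₁` is basic in the rank-two subarrangement determined
by `H₁ ∩ H₂`. -/
def basicDigraph (B : A.Region) : Digraph A.hyperplanes where
  Adj H₁ H₂ := H₁ ≠ H₂ ∧ A.IsBasic B (H₁.1 ⊓ H₂.1) H₁.1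

open Classical in
/-- `ν(H)`, the set of out-neighbours of `H` in the basic digraph. -/
def outNeighbors (B : A.Region) (H : A.hyperplanes) : Finset A.hyperplanes :=
  Finset.univ.filter fun H' => (A.basicDigraph B).Adj H H'

/-- What remains of `H` after cutting it: every codimension two subspace `L ⊆ H` defining a
rank-two subarrangement in which `H` is not basic is removed. -/
def cutHyperplane (B : A.Region) (H : A.hyperplanes) : Set (EuclideanSpace ℝ (Fin n)) :=
  {x | x ∈ H.1 ∧ ∀ L, A.DefinesRankTwo L → L ≤ H.1 → ¬ A.IsBasic B L H.1 → x ∉ L}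

/-- `T` is a shard contained in the hyperplane `H`. -/
def IsShard (B : A.Region) (H : A.hyperplanes) (T : Set (EuclideanSpace ℝ (Fin n))) : Prop :=
  ∃ x ∈ A.cutHyperplane B H, T = connectedComponentIn (A.cutHyperplane B H) x

/-- The upper regions of a shard `T` contained in `H`: the regions `R` meeting `T` in codimension
one with `H ∈ S(R)`. -/
def upperRegions (B : A.Region) (H : A.hyperplanes) (T : Set (EuclideanSpace ℝ (Fin n))) :
    Set (A.PosetOfRegions B) :=
  {R | MeetsInCodimOne (R.1 ∩ T) H.1 ∧ H ∈ A.sepSet B R}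

/-- `H` is the hyperplane associated with the join-irreducible region `J`, and so with every
subcritical pair `(J, M)`: the region `J` is minimal among the upper regions of some shard
contained in `H`. -/
def IsAssociatedHyperplane (B : A.Region) (J : A.PosetOfRegions B) (H : A.hyperplanes) : Prop :=
  ∃ T, A.IsShard B H T ∧ Minimal (· ∈ A.upperRegions B H T) J

/-- The vectors `v H` are normal vectors of the hyperplanes, with directions chosen such that
`S(R)` consists of the `H` with `⟪x, v H⟫ > 0` for all `x` in the interior of `R`. -/
def IsNormalSystem (B : A.Region) (v : A.hyperplanes → EuclideanSpace ℝ (Fin n)) : Prop :=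
  (∀ H, (Submodule.span ℝ {v H})ᗮ = H.1) ∧
    ∀ (R : A.PosetOfRegions B) (H : A.hyperplanes),
      H ∈ A.sepSet B R ↔ ∀ x ∈ interior R.1, 0 < ⟪x, v H⟫_ℝ

/-- The zonotope map `Z(R) = ∑_{H ∈ S(R)} v H`. -/
def zonotopeMap (B : A.Region) (v : A.hyperplanes → EuclideanSpace ℝ (Fin n))
    (R : A.PosetOfRegions B) : EuclideanSpace ℝ (Fin n) :=
  ∑ H ∈ A.sepSet B R, v H

/-- The `i`-th coordinate of the zonotope map with respect to a basis of `ℝⁿ`. -/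
def zonotopeCoord (B : A.Region) (v : A.hyperplanes → EuclideanSpace ℝ (Fin n))
    (b : Module.Basis (Fin n) ℝ (EuclideanSpace ℝ (Fin n))) (i : Fin n)
    (R : A.PosetOfRegions B) : ℝ :=
  b.repr (A.zonotopeMap B v R) i

end Arrangement

end

/-! ### Normal vectors, signs and separating sets. -/

namespace Arrangement

open scoped InnerProductSpace

variable {n : ℕ} {A : Arrangement n} {B : A.Region}
  {v : A.hyperplanes → EuclideanSpace ℝ (Fin n)}

/-! The region `J` has a wall in `H`, and crossing it gives a region `J' < J` with `S(J') = S(J) \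
{H}` (`exists_sepSet_eq_erase`). For a subcritical pair, `J' ≤ M` and `J ≰ M`, so `S(M)` contains
`S(J) \ {H}` but not `H`. Hence `Z(J) - Z(M)` equals `v H` minus the sum of `v K` over `K ∈ S(M) \
S(J)`.

Every such `K` is an out-neighbour of `H` (`mem_outNeighbors`). A hyperplane through `H ∩ K` has a
normal in the plane spanned by `v H` and `v K`, and comparing signs at `J`, `M` and the base region
shows that `H` bounds the base region of the rank-two subarrangement. Since the `i`-th coordinates
over `ν(H)` are nonnegative, the subtracted sum is at most the full sum over `ν(H)`, which is less
than the coordinate of `v H`. -/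

theorem IsNormalSystem.mem_iff (hv : A.IsNormalSystem B v) (H : A.hyperplanes)
    {x : EuclideanSpace ℝ (Fin n)} : x ∈ H.1 ↔ ⟪v H, x⟫_ℝ = 0 := by
  rw [← hv.1 H, Submodule.mem_orthogonal_singleton_iff_inner_right]

theorem IsNormalSystem.ker_eq (hv : A.IsNormalSystem B v) (H : A.hyperplanes) :
    LinearMap.ker (innerₛₗ ℝ (v H)) = H.1 := by
  ext x
  rw [hv.mem_iff H, LinearMap.mem_ker, innerₛₗ_apply_apply]

theorem isOpen_arrComplement (A : Finset (Submodule ℝ (EuclideanSpace ℝ (Fin n)))) :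
    IsOpen (arrComplement A) := by
  have h : arrComplement A = ⋂ H ∈ A, ((H : Set (EuclideanSpace ℝ (Fin n))))ᶜ := by
    ext x
    simp [arrComplement]
  rw [h]
  exact A.finite_toSet.isOpen_biInter fun H _ => H.closed_of_finiteDimensional.isOpen_compl

theorem mem_interior_region {A : Finset (Submodule ℝ (EuclideanSpace ℝ (Fin n)))}
    {x : EuclideanSpace ℝ (Fin n)} (hx : x ∈ arrComplement A) :
    x ∈ interior (closure (connectedComponentIn (arrComplement A) x)) :=
  interior_maximal subset_closure (isOpen_arrComplement A).connectedComponentIn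
    (mem_connectedComponentIn hx)

theorem IsNormalSystem.mem_sepSet_iff_mul_neg (hv : A.IsNormalSystem B v) (H : A.hyperplanes)
    {R : A.PosetOfRegions B} {x b : EuclideanSpace ℝ (Fin n)}
    (hx : x ∈ arrComplement A.hyperplanes)
    (hR : R.1 = closure (connectedComponentIn (arrComplement A.hyperplanes) x))
    (hb : b ∈ arrComplement A.hyperplanes)
    (hB : B.1 = closure (connectedComponentIn (arrComplement A.hyperplanes) b)) :
    H ∈ A.sepSet B R ↔ ⟪v H, x⟫_ℝ * ⟪v H, b⟫_ℝ < 0 := by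
  have hk := hv.ker_eq H
  have h := separates_iff (A := A) (f := innerₛₗ ℝ (v H)) (by rw [hk]; exact H.2) hx hb
  rw [hk, ← hR, ← hB] at h
  simpa [sepSet, sep] using h

/-- The base region has a generic point, on the negative side of all hyperplanes. -/
theorem IsNormalSystem.exists_base_point (hv : A.IsNormalSystem B v) :
    ∃ b ∈ arrComplement A.hyperplanes,
      B.1 = closure (connectedComponentIn (arrComplement A.hyperplanes) b) ∧
      ∀ H, ⟪v H, b⟫_ℝ < 0 := by
  obtain ⟨b, hb, hB⟩ := B.2
  refine ⟨b, hb, hB, fun H => ?_⟩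
  -- Every hyperplane separates the region of `-b` from `B`, so the sign convention applied to that
  -- region fixes the sign at `b`.
  have hnb : -b ∈ arrComplement A.hyperplanes := fun K hK h => hb K hK (by simpa using h)
  let R : A.PosetOfRegions B := ⟨_, -b, hnb, rfl⟩
  have h0 : ⟪v H, b⟫_ℝ ≠ 0 := fun h => hb _ H.2 ((hv.mem_iff H).2 h)
  have hmem : H ∈ A.sepSet B R := by
    rw [hv.mem_sepSet_iff_mul_neg H hnb rfl hb hB, inner_neg_right, neg_mul, neg_lt_zero]
    exact mul_self_pos.2 h0
  have h := (hv.2 R H).1 hmem (-b) (mem_interior_region hnb)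
  rwa [inner_neg_left, real_inner_comm, neg_pos] at h

theorem IsNormalSystem.mem_sepSet_iff (hv : A.IsNormalSystem B v) (H : A.hyperplanes)
    {R : A.PosetOfRegions B} {x : EuclideanSpace ℝ (Fin n)}
    (hx : x ∈ arrComplement A.hyperplanes)
    (hR : R.1 = closure (connectedComponentIn (arrComplement A.hyperplanes) x)) :
    H ∈ A.sepSet B R ↔ 0 < ⟪v H, x⟫_ℝ := by
  obtain ⟨b, hb, hB, hneg⟩ := hv.exists_base_point
  rw [hv.mem_sepSet_iff_mul_neg H hx hR hb hB]
  exact ⟨fun h => pos_of_mul_neg_left h (hneg H).le, fun h => mul_neg_of_pos_of_neg h (hneg H)⟩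

theorem IsNormalSystem.inner_ne_zero (hv : A.IsNormalSystem B v) (H : A.hyperplanes)
    {x : EuclideanSpace ℝ (Fin n)} (hx : x ∈ arrComplement A.hyperplanes) : ⟪v H, x⟫_ℝ ≠ 0 :=
  fun h => hx _ H.2 ((hv.mem_iff H).2 h)

theorem eq_of_le {H K : A.hyperplanes} (h : H.1 ≤ K.1) : H = K := by
  refine Subtype.ext (Submodule.eq_of_le_of_finrank_eq h ?_)
  have h1 := Submodule.finrank_quotient_add_finrank H.1
  have h2 := Submodule.finrank_quotient_add_finrank K.1
  rw [A.codim_one _ H.2] at h1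
  rw [A.codim_one _ K.2] at h2
  omega

/-- Such a point spans `H` modulo `H ∩ K`; the value `-1` puts it on the side of `K` containing the
base region. -/
theorem IsNormalSystem.exists_mem_inner_eq_neg_one (hv : A.IsNormalSystem B v)
    {H K : A.hyperplanes} (h : H ≠ K) : ∃ x ∈ H.1, ⟪v K, x⟫_ℝ = -1 := by
  obtain ⟨x, hx, hxK⟩ := SetLike.not_le_iff_exists.1 fun hle => h (eq_of_le hle)
  have h0 : ⟪v K, x⟫_ℝ ≠ 0 := fun h => hxK ((hv.mem_iff K).2 h)
  refine ⟨(-(⟪v K, x⟫_ℝ)⁻¹) • x, H.1.smul_mem _ hx, ?_⟩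
  rw [inner_smul_right, neg_mul, inv_mul_cancel₀ h0]

theorem IsNormalSystem.mul_inner_nonneg (hv : A.IsNormalSystem B v) (H : A.hyperplanes)
    {x y : EuclideanSpace ℝ (Fin n)} (hx : x ∈ arrComplement A.hyperplanes)
    (hy : y ∈ closure (connectedComponentIn (arrComplement A.hyperplanes) x)) :
    0 ≤ ⟪v H, x⟫_ℝ * ⟪v H, y⟫_ℝ := by
  have h0 := hv.inner_ne_zero H hx
  have hk : LinearMap.ker (innerₛₗ ℝ (⟪v H, x⟫_ℝ • v H)) = H.1 := by
    rw [map_smul, LinearMap.ker_smul _ _ h0, hv.ker_eq]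
  have h := pos_of_mem (A := A) (f := innerₛₗ ℝ (⟪v H, x⟫_ℝ • v H)) (by rw [hk]; exact H.2) hx
    (by rw [innerₛₗ_apply_apply, real_inner_smul_left]; exact mul_self_pos.2 h0) hy
  rwa [innerₛₗ_apply_apply, real_inner_smul_left] at h

/-! ### Crossing a wall. -/

/-- Crossing the wall `H` of a region `J` that lies above `H` removes `H`, and nothing else, from
the separating set. -/
theorem IsNormalSystem.exists_sepSet_eq_erase [DecidableEq A.hyperplanes]
    (hv : A.IsNormalSystem B v) {H : A.hyperplanes}
    {J : A.PosetOfRegions B} (hJ : MeetsInCodimOne J.1 H.1) (hHJ : H ∈ A.sepSet B J) :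
    ∃ J' : A.PosetOfRegions B, A.sepSet B J' = (A.sepSet B J).erase H := by
  obtain ⟨x, hx, hR⟩ := J.2
  -- For `K ≠ H` there is a point of `J ∩ H` off `K`: these points span `H`, which is not contained
  -- in `K`.
  have hq : ∀ K : A.hyperplanes, ∃ q ∈ H.1, (∀ L, 0 ≤ ⟪v L, x⟫_ℝ * ⟪v L, q⟫_ℝ) ∧
      (K ≠ H → ⟪v K, q⟫_ℝ ≠ 0) := by
    intro K
    by_cases hKH : K = H
    · exact ⟨0, H.1.zero_mem, fun L => by simp, fun h => absurd hKH h⟩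
    by_contra! hcon
    refine hKH (eq_of_le (H := H) (K := K) ?_).symm
    rw [← hJ]
    exact Submodule.span_le.2 fun q hq => (hv.mem_iff K).2
      (hcon q hq.2 fun L => hv.mul_inner_nonneg L hx (hR ▸ hq.1)).2
  choose q hqmem hqnn hq0 using hq
  -- Summing places `p` in the relative interior of the facet: the contributions on each `K ≠ H`
  -- have the same sign as `x`, and one is nonzero.
  set p := ∑ K, q K with hp
  have hpH : p ∈ H.1 := Submodule.sum_mem _ fun K _ => hqmem K
  have hpK : ∀ K : A.hyperplanes, K ≠ H → 0 < ⟪v K, x⟫_ℝ * ⟪v K, p⟫_ℝ := by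
    intro K hK
    rw [hp, inner_sum, Finset.mul_sum]
    refine Finset.sum_pos' (fun L _ => hqnn L K) ⟨K, Finset.mem_univ _, lt_of_le_of_ne (hqnn K K) ?_⟩
    exact (mul_ne_zero (hv.inner_ne_zero K hx) (hq0 K hK)).symm
  -- A small step from `p` away from `x` crosses `H` and preserves all other signs.
  have hev : ∀ᶠ ε : ℝ in nhdsWithin 0 (Set.Ioi 0), ∀ K : A.hyperplanes, K ≠ H →
      0 < ⟪v K, x⟫_ℝ * ⟪v K, p - ε • x⟫_ℝ := by
    refine Filter.Eventually.filter_mono nhdsWithin_le_nhds (Filter.eventually_all.2 fun K => ?_)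
    by_cases hK : K = H
    · exact Filter.Eventually.of_forall fun ε h => absurd hK h
    · have hc : Continuous fun ε : ℝ => ⟪v K, x⟫_ℝ * ⟪v K, p - ε • x⟫_ℝ := by fun_prop
      have h0 : 0 < ⟪v K, x⟫_ℝ * ⟪v K, p - (0 : ℝ) • x⟫_ℝ := by simpa using hpK K hK
      filter_upwards [hc.continuousAt.eventually (lt_mem_nhds h0)] with ε hε _ using hε
  obtain ⟨ε, hε, hε0⟩ := (hev.and self_mem_nhdsWithin).exists
  have hε0 : 0 < ε := hε0
  have hHx := (hv.mem_sepSet_iff H hx hR).1 hHJ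
  have hHy : ⟪v H, p - ε • x⟫_ℝ < 0 := by
    rw [inner_sub_right, (hv.mem_iff H).1 hpH, inner_smul_right, zero_sub, neg_lt_zero]
    exact mul_pos hε0 hHx
  have hy : p - ε • x ∈ arrComplement A.hyperplanes := by
    intro K hK hmem
    have h0 := (hv.mem_iff ⟨K, hK⟩).1 hmem
    by_cases hKH : (⟨K, hK⟩ : A.hyperplanes) = H
    · rw [hKH] at h0
      exact hHy.ne h0
    · have := hε _ hKH
      rw [h0, mul_zero] at this
      exact this.false
  let J' : A.PosetOfRegions B := ⟨_, _, hy, rfl⟩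
  refine ⟨J', Finset.ext fun K => ?_⟩
  rw [hv.mem_sepSet_iff K (R := J') hy rfl, Finset.mem_erase, hv.mem_sepSet_iff K hx hR]
  by_cases hKH : K = H
  · subst hKH
    simp [hHy.le]
  · have h := hε K hKH
    simp only [ne_eq, hKH, not_false_eq_true, true_and]
    exact (pos_iff_pos_of_mul_pos h).symm

/-! ### Basic hyperplanes and out-neighbours. -/

/-- If the hyperplanes other than `H` through `H ∩ K` are negative on the part of `H` below `K`,
then `H` is basic in the rank-two subarrangement defined by `H ∩ K`. -/
theorem IsNormalSystem.isBasic_inf (hv : A.IsNormalSystem B v) {H K : A.hyperplanes}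
    (hHK : H ≠ K)
    (hneg : ∀ G : A.hyperplanes, H.1 ⊓ K.1 ≤ G.1 → G ≠ H →
      ∀ x ∈ H.1, ⟪v K, x⟫_ℝ < 0 → ⟪v G, x⟫_ℝ < 0) :
    A.IsBasic B (H.1 ⊓ K.1) H.1 := by
  classical
  obtain ⟨b, hb, hB, hbneg⟩ := hv.exists_base_point
  have hsub : arrComplement A.hyperplanes ⊆ arrComplement (A.containing (H.1 ⊓ K.1)) :=
    fun x hx L hL => hx L (Finset.mem_filter.1 hL).1
  refine ⟨Finset.mem_filter.2 ⟨H.2, inf_le_left⟩, _, ⟨b, hsub hb, rfl⟩, ?_, ?_⟩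
  · rw [hB]
    exact closure_mono (connectedComponentIn_mono _ hsub)
  have key : ∀ x ∈ H.1, ⟪v K, x⟫_ℝ < 0 →
      x ∈ closure (connectedComponentIn (arrComplement (A.containing (H.1 ⊓ K.1))) b) := by
    intro x hx hxK
    -- Along the segment from `b` towards `x` all normals of the subarrangement stay negative; only
    -- the endpoint `x` lies on `H`.
    have hseg : openSegment ℝ b x ∪ {b} ⊆ arrComplement (A.containing (H.1 ⊓ K.1)) := by
      rintro z (⟨s, t, hs, ht, -, rfl⟩ | rfl)
      · intro L hL hz
        obtain ⟨hLA, hLle⟩ := Finset.mem_filter.1 hL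
        have hz := (hv.mem_iff ⟨L, hLA⟩).1 hz
        rw [inner_add_right, inner_smul_right, inner_smul_right] at hz
        have h1 := mul_neg_of_pos_of_neg hs (hbneg ⟨L, hLA⟩)
        have h2 : ⟪v ⟨L, hLA⟩, x⟫_ℝ ≤ 0 := by
          by_cases hLH : (⟨L, hLA⟩ : A.hyperplanes) = H
          · rw [hLH, (hv.mem_iff H).1 hx]
          · exact (hneg ⟨L, hLA⟩ hLle hLH x hx hxK).le
        have h3 := mul_nonpos_of_nonneg_of_nonpos ht.le h2
        linarith
      · exact hsub hb
    have hconn : IsPreconnected (openSegment ℝ b x ∪ {b}) := by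
      refine (convex_openSegment b x).isPreconnected.subset_closure Set.subset_union_left ?_
      rw [closure_openSegment]
      exact Set.union_subset (openSegment_subset_segment ℝ b x)
        (Set.singleton_subset_iff.2 (left_mem_segment ℝ b x))
    have h := hconn.subset_connectedComponentIn (Or.inr rfl) hseg
    refine closure_mono (Set.subset_union_left.trans h) ?_
    rw [closure_openSegment]
    exact right_mem_segment ℝ b x
  refine le_antisymm (Submodule.span_le.2 Set.inter_subset_right) fun y hy => ?_
  obtain ⟨x, hx, hxK⟩ := hv.exists_mem_inner_eq_neg_one hHK
  have hmem : ∀ z ∈ H.1, ⟪v K, z⟫_ℝ < 0 → z ∈ Submodule.span ℝ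
      (closure (connectedComponentIn (arrComplement (A.containing (H.1 ⊓ K.1))) b) ∩
        (H.1 : Set (EuclideanSpace ℝ (Fin n)))) :=
    fun z hz hzK => Submodule.subset_span ⟨key z hz hzK, hz⟩
  -- The open half of `H` where `v K` is negative spans `H`: the coefficient is chosen so that `v K`
  -- takes the value `-1` on this vector.
  have hsum : y + (⟪v K, y⟫_ℝ + 1) • x ∈ Submodule.span ℝ
      (closure (connectedComponentIn (arrComplement (A.containing (H.1 ⊓ K.1))) b) ∩
        (H.1 : Set (EuclideanSpace ℝ (Fin n)))) := by
    refine hmem _ (H.1.add_mem hy (H.1.smul_mem _ hx)) ?_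
    rw [inner_add_right, inner_smul_right, hxK]
    linarith
  have hxs := hmem x hx (by rw [hxK]; norm_num)
  simpa using Submodule.sub_mem _ hsum (Submodule.smul_mem _ (⟪v K, y⟫_ℝ + 1) hxs)

/-- If `S(J)` and `S(M)` contain the same hyperplanes, apart from `H` that belongs to `S(J)` only
and further elements of `S(M)`, then these further elements are out-neighbours of `H`. -/
theorem IsNormalSystem.mem_outNeighbors (hv : A.IsNormalSystem B v) {H K : A.hyperplanes}
    {J M : A.PosetOfRegions B} (hHJ : H ∈ A.sepSet B J) (hHM : H ∉ A.sepSet B M)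
    (hJM : ∀ G ∈ A.sepSet B J, G ≠ H → G ∈ A.sepSet B M)
    (hKM : K ∈ A.sepSet B M) (hKJ : K ∉ A.sepSet B J) : K ∈ A.outNeighbors B H := by
  classical
  have hHK : H ≠ K := fun h => hKJ (h ▸ hHJ)
  refine Finset.mem_filter.2 ⟨Finset.mem_univ _, hHK, hv.isBasic_inf hHK ?_⟩
  intro G hG hGH y hy hyK
  obtain ⟨b, -, -, hbneg⟩ := hv.exists_base_point
  obtain ⟨x, hx, hxK⟩ := hv.exists_mem_inner_eq_neg_one hHK
  obtain ⟨w, hw, hwH⟩ := hv.exists_mem_inner_eq_neg_one hHK.symm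
  have hx := (hv.mem_iff H).1 hx
  have hw := (hv.mem_iff K).1 hw
  -- Up to sign, `x` and `w` are dual to `v K` and `v H`, so this expands `v G` in those two
  -- normals.
  have hexp : ∀ z, ⟪v G, z⟫_ℝ = -(⟪v K, z⟫_ℝ * ⟪v G, x⟫_ℝ) - ⟪v H, z⟫_ℝ * ⟪v G, w⟫_ℝ := by
    intro z
    have hmem : z + ⟪v K, z⟫_ℝ • x + ⟪v H, z⟫_ℝ • w ∈ G.1 := by
      refine hG ⟨(hv.mem_iff H).2 ?_, (hv.mem_iff K).2 ?_⟩ <;>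
        simp only [inner_add_right, inner_smul_right, hx, hw, hxK, hwH] <;> ring
    have h := (hv.mem_iff G).1 hmem
    simp only [inner_add_right, inner_smul_right] at h
    linarith
  have hGx0 : ⟪v G, x⟫_ℝ ≠ 0 := by
    intro h0
    refine hGH (eq_of_le (H := H) fun z hz => (hv.mem_iff G).2 ?_).symm
    rw [hexp z, (hv.mem_iff H).1 hz, h0]
    ring
  have hGx : ⟪v G, x⟫_ℝ < 0 := by
    -- Otherwise `v G` has a negative coefficient on `v K` and, by negativity at `b`, a positive one
    -- on `v H`. Then `G ∈ S(J)`, hence `G ∈ S(M)`, yet the signs of `H` and `K` at `M` make `v G`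
    -- negative there.
    refine lt_of_le_of_ne (not_lt.1 fun hpos => ?_) hGx0
    have hGw : ⟪v G, w⟫_ℝ < 0 := by
      have h1 := hexp b
      have h2 := mul_neg_of_neg_of_pos (hbneg K) hpos
      have h3 : 0 < ⟪v H, b⟫_ℝ * ⟪v G, w⟫_ℝ := by linarith [hbneg G]
      exact neg_of_mul_pos_right h3 (hbneg H).le
    obtain ⟨j, hj, hjR⟩ := J.2
    obtain ⟨m, hm, hmR⟩ := M.2
    rw [hv.mem_sepSet_iff _ hj hjR] at hHJ hKJ
    rw [hv.mem_sepSet_iff _ hm hmR] at hHM hKM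
    have hGJ : G ∈ A.sepSet B J := by
      rw [hv.mem_sepSet_iff _ hj hjR, hexp j]
      have h1 := mul_nonpos_of_nonpos_of_nonneg (not_lt.1 hKJ) hpos.le
      have h2 := mul_neg_of_pos_of_neg hHJ hGw
      linarith
    have hGM := hJM G hGJ hGH
    rw [hv.mem_sepSet_iff _ hm hmR, hexp m] at hGM
    have h1 := mul_pos hKM hpos
    have h2 := mul_nonneg_of_nonpos_of_nonpos (not_lt.1 hHM) hGw.le
    linarith
  rw [hexp y, (hv.mem_iff H).1 hy]
  have := mul_pos_of_neg_of_neg hyK hGx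
  linarith

end Arrangement

theorem mainTheorem10 {n : ℕ} (A : Arrangement n) (B : A.Region)
    (v : A.hyperplanes → EuclideanSpace ℝ (Fin n)) (hv : A.IsNormalSystem B v)
    (b : Module.Basis (Fin n) ℝ (EuclideanSpace ℝ (Fin n))) (i : Fin n)
    (H : A.hyperplanes)
    (hnonneg : ∀ H' ∈ A.outNeighbors B H, 0 ≤ b.repr (v H') i)
    (hlt : ∑ H' ∈ A.outNeighbors B H, b.repr (v H') i < b.repr (v H) i) :
    ∀ J M : A.PosetOfRegions B, Subcritical J M → A.IsAssociatedHyperplane B J H →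
      Reverses (A.zonotopeCoord B v b i) J M := by
  classical
  rintro J M ⟨hnle, hlow, -⟩ ⟨T, -, ⟨hT, hHJ⟩, -⟩
  have hJ : MeetsInCodimOne J.1 H.1 := le_antisymm (Submodule.span_le.2 Set.inter_subset_right)
    (hT.ge.trans (Submodule.span_mono (Set.inter_subset_inter_left _ Set.inter_subset_left)))
  obtain ⟨J', hJ'⟩ := hv.exists_sepSet_eq_erase hJ hHJ
  have hlt' : J' < J := by
    refine lt_of_le_of_ne (show A.sepSet B J' ⊆ A.sepSet B J from hJ' ▸ Finset.erase_subset _ _) ?_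
    rintro rfl
    exact Finset.notMem_erase H _ (hJ' ▸ hHJ)
  have hsub : (A.sepSet B J).erase H ⊆ A.sepSet B M := hJ' ▸ hlow J' hlt'
  have hJM : ∀ G ∈ A.sepSet B J, G ≠ H → G ∈ A.sepSet B M := fun G hG hGH =>
    hsub (Finset.mem_erase.2 ⟨hGH, hG⟩)
  have hHM : H ∉ A.sepSet B M := fun h => hnle fun G hG => by
    by_cases hGH : G = H
    · exact hGH ▸ h
    · exact hJM G hG hGH
  have hout : A.sepSet B M \ (A.sepSet B J).erase H ⊆ A.outNeighbors B H := by
    intro K hK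
    obtain ⟨hKM, hKJ⟩ := Finset.mem_sdiff.1 hK
    exact hv.mem_outNeighbors hHJ hHM hJM hKM fun h =>
      hKJ (Finset.mem_erase.2 ⟨fun h' => hHM (h' ▸ hKM), h⟩)
  have hZ : ∀ R, A.zonotopeCoord B v b i R = ∑ K ∈ A.sepSet B R, b.repr (v K) i := by
    intro R
    simp [Arrangement.zonotopeCoord, Arrangement.zonotopeMap, Finsupp.finsetSum_apply]
  have hle := Finset.sum_le_sum_of_subset_of_nonneg hout fun K hK _ => hnonneg K hK
  -- The common part `S(J) \ {H}` is split off both sums and cancels.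
  rw [Reverses, hZ, hZ, ← Finset.sum_sdiff hsub, ← Finset.add_sum_erase _ _ hHJ]
  linarith
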